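/- Let $k$ be a field. A Lie algebra over $k$ is called metabelian if it satisfies the identity $(a\circ b)\circ(c\circ d)=0$. For a Lie algebra $L$ over $k$, the commutant $L^2$ is the ideal generated by all products $a\circ b$ with $a,b\in L$, and the Fitting radical $\mathrm{Fit}(L)$ is the ideal generated by all elements of nilpotent ideals of $L$ (an ideal being nilpotent if it is nilpotent as a Lie algebra). If $Z$ is a set and $R$ is a subset of the free Lie algebra on $Z$ over $k$, then $\langle Z\mid R\rangle_{\mathcal A^2}$ denotes the quotient of this free Lie algebra by the ideal generated by $R$ and by all elements $(a\circ b)\circ(c\circ d)$. Let $A$ and $B$ be nonzero metabelian Lie algebras over $k$ (of arbitrary dimension), with presentations $A\cong\langle Z_A\mid R_A\rangle_{\mathcal A^2}$ and $B\cong\langle Z_B\mid R_B\rangle_{\mathcal A^2}$ where $Z_A\cap Z_B=\emptyset$, and let $$A\ast B=\langle Z_A\cup Z_B\mid R_A\cup R_B\rangle_{\mathcal A^2}$$ be their metabelian product. Then $$\mathrm{Fit}(A\ast B)=(A\ast B)^2 .$$ -/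

import Mathlib

/-- A Lie algebra is metabelian when `(a ∘ b) ∘ (c ∘ d) = 0` holds identically. -/
def IsMetabelian (A : Type*) [LieRing A] : Prop :=
  ∀ a b c d : A, ⁅⁅a, b⁆, ⁅c, d⁆⁆ = 0

/-- The commutant `A²`: the ideal generated by all products `a ∘ b`. -/
def commutant (k A : Type*) [CommRing k] [LieRing A] [LieAlgebra k A] : LieIdeal k A :=
  LieSubmodule.lieSpan k A {x : A | ∃ a b : A, ⁅a, b⁆ = x}

/-- The Fitting radical: the ideal generated by all elements of nilpotent ideals. Nilpotency of an
ideal `I` means that `I` is nilpotent as a Lie algebra in its own right. -/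
def fittingRadical (k A : Type*) [CommRing k] [LieRing A] [LieAlgebra k A] : LieIdeal k A :=
  LieSubmodule.lieSpan k A {x : A | ∃ I : LieIdeal k A, LieRing.IsNilpotent I ∧ x ∈ I}

/-- The ideal of the free Lie algebra `F` on `ι` generated by the set `R` of relators together with
all values `(a ∘ b) ∘ (c ∘ d)` of the metabelian identity. -/
noncomputable def metabelianRelationIdeal {k ι : Type*} [CommRing k] (R : Set (FreeLieAlgebra k ι)) :
    LieIdeal k (FreeLieAlgebra k ι) :=
  LieSubmodule.lieSpan k (FreeLieAlgebra k ι)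
    (R ∪ {x | ∃ a b c d : FreeLieAlgebra k ι, ⁅⁅a, b⁆, ⁅c, d⁆⁆ = x})

/-- The Lie algebra `⟨z_i, i ∈ ι | R⟩` presented by generators and relators in the variety of
metabelian Lie algebras. -/
abbrev MetabelianPresented {k ι : Type*} [CommRing k] (R : Set (FreeLieAlgebra k ι)) : Type _ :=
  FreeLieAlgebra k ι ⧸ metabelianRelationIdeal R

/-- A presentation of `A`, with generators indexed by `ι`, in the variety of metabelian Lie
algebras over `k`. -/
structure MetabelianPresentation (k A ι : Type*) [CommRing k] [LieRing A] [LieAlgebra k A] where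
  /-- The relators. -/
  relators : Set (FreeLieAlgebra k ι)
  /-- The identification of the presented algebra with `A`. -/
  equiv : MetabelianPresented relators ≃ₗ⁅k⁆ A

/-- Renaming of generators in the free Lie algebra. -/
noncomputable def freeLieRename (k : Type*) {ι κ : Type*} [CommRing k] (f : ι → κ) :
    FreeLieAlgebra k ι →ₗ⁅k⁆ FreeLieAlgebra k κ :=
  FreeLieAlgebra.lift k fun i => FreeLieAlgebra.of k (f i)

/-- The metabelian product `A ∗ B = ⟨z_i, i ∈ I ⊔ J | R_A ∪ R_B⟩`, formed from presentations
`A = ⟨z_i, i ∈ I | R_A⟩` and `B = ⟨z_j, j ∈ J | R_B⟩`; the disjoint union of the sets of generators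
is the sum type `I ⊕ J`. -/
abbrev MetabelianProduct {k A B I J : Type*} [CommRing k] [LieRing A] [LieAlgebra k A]
    [LieRing B] [LieAlgebra k B]
    (P : MetabelianPresentation k A I) (Q : MetabelianPresentation k B J) : Type _ :=
  MetabelianPresented
    (freeLieRename k (Sum.inl : I → I ⊕ J) '' P.relators ∪
      freeLieRename k (Sum.inr : J → I ⊕ J) '' Q.relators)

/-! The commutant of a metabelian algebra is an abelian ideal, hence lies in the Fitting radical.
Conversely, an element `x` of a nilpotent ideal outside the commutant is detected by a functional
`l` killing commutators. The coproduct property gives two maps to the algebra `⁅e, n⁆ = n`: each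
sends one factor along `l` into the line of `e` and the other by a nonzero character into the line
of `n`. Nilpotency kills the `e`-coordinate of `x` under both
(`AffineLie.fst_eq_zero_of_mem_nilpotent`); these coordinates sum to `l x`, a contradiction. -/

theorem freeLieRename_of {k ι κ : Type*} [CommRing k] (f : ι → κ) (i : ι) :
    freeLieRename k f (FreeLieAlgebra.of k i) = FreeLieAlgebra.of k (f i) :=
  FreeLieAlgebra.lift_of_apply _ _

/-! ### Universal property of metabelian presentations. -/

section Presented

variable {k ι L : Type*} [CommRing k] [LieRing L] [LieAlgebra k L]
  {R : Set (FreeLieAlgebra k ι)}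

/-- The projection of the free Lie algebra onto a presented metabelian algebra. -/
noncomputable def presentedMk (R : Set (FreeLieAlgebra k ι)) :
    FreeLieAlgebra k ι →ₗ⁅k⁆ MetabelianPresented R where
  toLinearMap := (metabelianRelationIdeal R).toSubmodule.mkQ
  map_lie' := rfl

theorem presentedMk_surjective : Function.Surjective (presentedMk R) :=
  Submodule.mkQ_surjective _

theorem presentedMk_eq_zero {u : FreeLieAlgebra k ι} :
    presentedMk R u = 0 ↔ u ∈ metabelianRelationIdeal R :=
  Submodule.Quotient.mk_eq_zero _

theorem isMetabelian_presented : IsMetabelian (MetabelianPresented R) := by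
  intro a b c d
  obtain ⟨a, rfl⟩ := presentedMk_surjective a
  obtain ⟨b, rfl⟩ := presentedMk_surjective b
  obtain ⟨c, rfl⟩ := presentedMk_surjective c
  obtain ⟨d, rfl⟩ := presentedMk_surjective d
  simp only [← LieHom.map_lie]
  exact presentedMk_eq_zero.2 (LieSubmodule.subset_lieSpan (Or.inr ⟨a, b, c, d, rfl⟩))

theorem metabelianRelationIdeal_le_ker (hL : IsMetabelian L) (F : FreeLieAlgebra k ι →ₗ⁅k⁆ L)
    (hF : ∀ r ∈ R, F r = 0) : metabelianRelationIdeal R ≤ F.ker := by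
  refine LieSubmodule.lieSpan_le.2 ?_
  rintro x (hx | ⟨a, b, c, d, rfl⟩)
  · exact LieHom.mem_ker.2 (hF x hx)
  · refine LieHom.mem_ker.2 ?_
    simp only [LieHom.map_lie, hL _ _ _ _]

/-- The universal property of a presented metabelian algebra. -/
noncomputable def presentedLift (hL : IsMetabelian L) (F : FreeLieAlgebra k ι →ₗ⁅k⁆ L)
    (hF : ∀ r ∈ R, F r = 0) : MetabelianPresented R →ₗ⁅k⁆ L where
  toLinearMap := (metabelianRelationIdeal R).toSubmodule.liftQ (F : FreeLieAlgebra k ι →ₗ[k] L)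
    fun _ hx => LieHom.mem_ker.1 (metabelianRelationIdeal_le_ker hL F hF hx)
  map_lie' := by
    intro x y
    obtain ⟨x, rfl⟩ := presentedMk_surjective x
    obtain ⟨y, rfl⟩ := presentedMk_surjective y
    exact F.map_lie x y

theorem presented_hom_ext {f g : MetabelianPresented R →ₗ⁅k⁆ L}
    (h : ∀ i, f (presentedMk R (FreeLieAlgebra.of k i)) = g (presentedMk R (FreeLieAlgebra.of k i)))
    (x : MetabelianPresented R) : f x = g x := by
  obtain ⟨u, rfl⟩ := presentedMk_surjective x
  have : f.comp (presentedMk R) = g.comp (presentedMk R) := FreeLieAlgebra.hom_ext h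
  exact LieHom.congr_fun this u

end Presented

namespace MetabelianProduct

variable {k A B I J L : Type*} [CommRing k] [LieRing A] [LieAlgebra k A]
  [LieRing B] [LieAlgebra k B] [LieRing L] [LieAlgebra k L]
  (P : MetabelianPresentation k A I) (Q : MetabelianPresentation k B J)

/-- The canonical map from the left factor to the metabelian product. -/
noncomputable def inlHom : A →ₗ⁅k⁆ MetabelianProduct P Q :=
  (presentedLift isMetabelian_presented ((presentedMk _).comp (freeLieRename k Sum.inl))
    fun _ hr => presentedMk_eq_zero.2
      (LieSubmodule.subset_lieSpan (Or.inl (Or.inl (Set.mem_image_of_mem _ hr))))).comp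
    P.equiv.symm.toLieHom

/-- The canonical map from the right factor to the metabelian product. -/
noncomputable def inrHom : B →ₗ⁅k⁆ MetabelianProduct P Q :=
  (presentedLift isMetabelian_presented ((presentedMk _).comp (freeLieRename k Sum.inr))
    fun _ hr => presentedMk_eq_zero.2
      (LieSubmodule.subset_lieSpan (Or.inl (Or.inr (Set.mem_image_of_mem _ hr))))).comp
    Q.equiv.symm.toLieHom

theorem inlHom_equiv_mk (u : FreeLieAlgebra k I) :
    inlHom P Q (P.equiv (presentedMk _ u)) = presentedMk _ (freeLieRename k Sum.inl u) := by
  rw [inlHom, LieHom.comp_apply]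
  exact congrArg _ (P.equiv.symm_apply_apply (presentedMk _ u))

theorem inrHom_equiv_mk (u : FreeLieAlgebra k J) :
    inrHom P Q (Q.equiv (presentedMk _ u)) = presentedMk _ (freeLieRename k Sum.inr u) := by
  rw [inrHom, LieHom.comp_apply]
  exact congrArg _ (Q.equiv.symm_apply_apply (presentedMk _ u))

theorem hom_ext {f g : MetabelianProduct P Q →ₗ⁅k⁆ L}
    (hl : ∀ a, f (inlHom P Q a) = g (inlHom P Q a))
    (hr : ∀ b, f (inrHom P Q b) = g (inrHom P Q b)) (x : MetabelianProduct P Q) : f x = g x := by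
  refine presented_hom_ext ?_ x
  rintro (i | j)
  · have := hl (P.equiv (presentedMk _ (FreeLieAlgebra.of k i)))
    rwa [inlHom_equiv_mk, freeLieRename_of] at this
  · have := hr (Q.equiv (presentedMk _ (FreeLieAlgebra.of k j)))
    rwa [inrHom_equiv_mk, freeLieRename_of] at this

/-- The metabelian product is the coproduct in the variety of metabelian Lie algebras. -/
theorem exists_desc (hL : IsMetabelian L) (φ : A →ₗ⁅k⁆ L) (ψ : B →ₗ⁅k⁆ L) :
    ∃ h : MetabelianProduct P Q →ₗ⁅k⁆ L,
      (∀ a, h (inlHom P Q a) = φ a) ∧ ∀ b, h (inrHom P Q b) = ψ b := by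
  let p := (φ.comp P.equiv.toLieHom).comp (presentedMk P.relators)
  let q := (ψ.comp Q.equiv.toLieHom).comp (presentedMk Q.relators)
  let F : FreeLieAlgebra k (I ⊕ J) →ₗ⁅k⁆ L := FreeLieAlgebra.lift k
    (Sum.elim (fun i => p (FreeLieAlgebra.of k i)) fun j => q (FreeLieAlgebra.of k j))
  have hp : F.comp (freeLieRename k Sum.inl) = p :=
    FreeLieAlgebra.hom_ext fun i => by simp [F, freeLieRename_of]
  have hq : F.comp (freeLieRename k Sum.inr) = q :=
    FreeLieAlgebra.hom_ext fun j => by simp [F, freeLieRename_of]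
  have hpr : ∀ r ∈ P.relators, p r = 0 := fun r hr => by
    have : presentedMk P.relators r = 0 :=
      presentedMk_eq_zero.2 (LieSubmodule.subset_lieSpan (Or.inl hr))
    simp only [p, LieHom.comp_apply, this, map_zero]
  have hqr : ∀ r ∈ Q.relators, q r = 0 := fun r hr => by
    have : presentedMk Q.relators r = 0 :=
      presentedMk_eq_zero.2 (LieSubmodule.subset_lieSpan (Or.inl hr))
    simp only [q, LieHom.comp_apply, this, map_zero]
  refine ⟨presentedLift hL F ?_, fun a => ?_, fun b => ?_⟩
  · rintro _ (⟨r, hr, rfl⟩ | ⟨r, hr, rfl⟩)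
    · exact (LieHom.congr_fun hp r).trans (hpr r hr)
    · exact (LieHom.congr_fun hq r).trans (hqr r hr)
  · obtain ⟨a, rfl⟩ := P.equiv.surjective a
    obtain ⟨u, rfl⟩ := presentedMk_surjective a
    refine (congrArg _ (inlHom_equiv_mk P Q u)).trans ?_
    exact LieHom.congr_fun hp u
  · obtain ⟨b, rfl⟩ := Q.equiv.surjective b
    obtain ⟨u, rfl⟩ := presentedMk_surjective b
    refine (congrArg _ (inrHom_equiv_mk P Q u)).trans ?_
    exact LieHom.congr_fun hq u

end MetabelianProduct

/-! ### Commutants and nilpotent ideals. -/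

section Commutant

variable {k L : Type*} [CommRing k] [LieRing L] [LieAlgebra k L]

theorem lie_mem_commutant (a b : L) : ⁅a, b⁆ ∈ commutant k L :=
  LieSubmodule.subset_lieSpan ⟨a, b, rfl⟩

/-- The linear span of products is already an ideal, since bracketing anything with an element
yields a product. -/
theorem commutant_toSubmodule :
    (commutant k L).toSubmodule = Submodule.span k {x : L | ∃ a b : L, ⁅a, b⁆ = x} := by
  refine le_antisymm ?_ LieSubmodule.submodule_span_le_lieSpan
  let N : LieIdeal k L :=
    { Submodule.span k {x : L | ∃ a b : L, ⁅a, b⁆ = x} with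
      lie_mem := fun {x m} _ => Submodule.subset_span ⟨x, m, rfl⟩ }
  exact (LieSubmodule.lieSpan_le (N := N)).2 Submodule.subset_span

theorem IsMetabelian.lie_eq_zero_of_mem_commutant (h : IsMetabelian L) {x y : L}
    (hx : x ∈ commutant k L) (hy : y ∈ commutant k L) : ⁅x, y⁆ = 0 := by
  rw [← LieSubmodule.mem_toSubmodule, commutant_toSubmodule] at hx hy
  induction hx, hy using Submodule.span_induction₂ with
  | mem_mem x y hx hy =>
    obtain ⟨a, b, rfl⟩ := hx
    obtain ⟨c, d, rfl⟩ := hy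
    exact h a b c d
  | zero_left => simp
  | zero_right => simp
  | add_left => simp [*]
  | add_right => simp [*]
  | smul_left => simp [*]
  | smul_right => simp [*]

theorem IsMetabelian.commutant_le_fittingRadical (h : IsMetabelian L) :
    commutant k L ≤ fittingRadical k L := by
  intro x hx
  refine LieSubmodule.subset_lieSpan ⟨commutant k L, ?_, hx⟩
  have : IsLieAbelian (commutant k L) :=
    ⟨fun x y => Subtype.ext (h.lie_eq_zero_of_mem_commutant x.2 y.2)⟩
  infer_instance

/-- A nonzero metabelian Lie algebra is not perfect. -/
theorem IsMetabelian.commutant_ne_top [Nontrivial L] (h : IsMetabelian L) :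
    commutant k L ≠ ⊤ := by
  intro ht
  -- The commutant is abelian, so if it were everything, all products would vanish and it would be
  -- zero.
  have hab : ∀ a b : L, ⁅a, b⁆ = 0 := fun a b =>
    h.lie_eq_zero_of_mem_commutant (k := k) (ht ▸ LieSubmodule.mem_top a)
      (ht ▸ LieSubmodule.mem_top b)
  have hbot : commutant k L = ⊥ := by
    refine (LieSubmodule.lieSpan_eq_bot_iff _ _ _).2 ?_
    rintro _ ⟨a, b, rfl⟩
    exact hab a b
  obtain ⟨x, hx⟩ := exists_ne (0 : L)
  have : x ∈ commutant k L := ht ▸ LieSubmodule.mem_top x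
  rw [hbot] at this
  exact hx ((LieSubmodule.mem_bot x).1 this)

/-- Elements of nilpotent ideals act nilpotently. -/
theorem exists_ad_pow_lie_eq_zero {I : LieIdeal k L} (hI : LieRing.IsNilpotent I) {x : L}
    (hx : x ∈ I) : ∃ n : ℕ, ∀ y, ((LieAlgebra.ad k L x) ^ n) ⁅x, y⁆ = 0 := by
  obtain ⟨n, hn⟩ := LieModule.exists_forall_pow_toEnd_eq_zero k I I
  refine ⟨n, fun y => ?_⟩
  have key : ∀ (m : ℕ) (z : I),
      (((LieModule.toEnd k I I ⟨x, hx⟩) ^ m) z : L) = ((LieAlgebra.ad k L x) ^ m) z := by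
    intro m
    induction m with
    | zero => simp
    | succ m ih =>
      intro z
      rw [pow_succ, pow_succ, Module.End.mul_apply, Module.End.mul_apply, ih]
      rfl
  -- The first bracket with `x` moves an arbitrary `y` into `I`, where `ad x` is nilpotent.
  have := key n ⟨⁅x, y⁆, lie_mem_left k L I x y hx⟩
  rw [hn] at this
  exact this.symm

end Commutant

/-- The two-dimensional Lie algebra with basis `e, n` and `⁅e, n⁆ = n`. -/
@[ext]
structure AffineLie (k : Type*) where
  /-- The coefficient of `e`. -/
  fst : k
  /-- The coefficient of `n`. -/
  snd : k

namespace AffineLie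

section CommRing

variable {k : Type*} [CommRing k]

/-- The coordinates of an element. -/
def toProd : AffineLie k ≃ k × k where
  toFun x := (x.fst, x.snd)
  invFun x := ⟨x.1, x.2⟩

instance : AddCommGroup (AffineLie k) := toProd.addCommGroup

instance : Module k (AffineLie k) := toProd.module k

instance : Bracket (AffineLie k) (AffineLie k) :=
  ⟨fun x y => ⟨0, x.fst * y.snd - y.fst * x.snd⟩⟩

@[simp] theorem fst_zero : (0 : AffineLie k).fst = 0 := rfl
@[simp] theorem snd_zero : (0 : AffineLie k).snd = 0 := rfl
@[simp] theorem fst_add (x y : AffineLie k) : (x + y).fst = x.fst + y.fst := rfl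
@[simp] theorem snd_add (x y : AffineLie k) : (x + y).snd = x.snd + y.snd := rfl
@[simp] theorem fst_smul (t : k) (x : AffineLie k) : (t • x).fst = t * x.fst := rfl
@[simp] theorem snd_smul (t : k) (x : AffineLie k) : (t • x).snd = t * x.snd := rfl
@[simp] theorem fst_lie (x y : AffineLie k) : ⁅x, y⁆.fst = 0 := rfl
@[simp] theorem snd_lie (x y : AffineLie k) :
    ⁅x, y⁆.snd = x.fst * y.snd - y.fst * x.snd := rfl

instance : LieRing (AffineLie k) where
  add_lie x y z := by ext <;> simp; ring
  lie_add x y z := by ext <;> simp; ring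
  lie_self x := by ext <;> simp
  leibniz_lie x y z := by ext <;> simp; ring

instance : LieAlgebra k (AffineLie k) where
  lie_smul t x y := by ext <;> simp; ring

theorem isMetabelian : IsMetabelian (AffineLie k) := by
  intro a b c d
  ext
  · exact fst_lie _ _
  · rw [snd_lie, fst_lie, fst_lie, zero_mul, zero_mul, sub_self, snd_zero]

/-- The first coordinate as a linear functional. -/
def fstₗ : AffineLie k →ₗ[k] k where
  toFun := fst
  map_add' := fst_add
  map_smul' := fst_smul

variable {L : Type*} [LieRing L] [LieAlgebra k L]

/-- The homomorphism `x ↦ f x • (c e + d n)` for a functional `f` vanishing on commutators. -/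
def ofFunctional (c d : k) (f : L →ₗ[k] k) (hf : ∀ x y : L, f ⁅x, y⁆ = 0) : L →ₗ⁅k⁆ AffineLie k where
  toFun x := ⟨f x * c, f x * d⟩
  map_add' x y := by ext <;> simp [add_mul]
  map_smul' t x := by ext <;> simp [mul_assoc]
  map_lie' {x y} := by ext <;> simp [hf]; ring

@[simp] theorem ofFunctional_apply (c d : k) (f : L →ₗ[k] k) (hf : ∀ x y : L, f ⁅x, y⁆ = 0) (x : L) :
    ofFunctional c d f hf x = ⟨f x * c, f x * d⟩ := rfl

/-- On the line of `n`, bracketing with an element is scaling by its `e`-coordinate. -/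
theorem apply_ad_pow (h : L →ₗ⁅k⁆ AffineLie k) (x z : L) (hz : (h z).fst = 0) (n : ℕ) :
    h (((LieAlgebra.ad k L x) ^ n) z) = ⟨0, (h x).fst ^ n * (h z).snd⟩ := by
  induction n with
  | zero => ext <;> simp [hz]
  | succ n ih =>
    rw [pow_succ', Module.End.mul_apply, LieAlgebra.ad_apply, LieHom.map_lie, ih]
    ext <;> simp
    ring

end CommRing

/-- A homomorphism to the two-dimensional algebra whose image contains `n` sends elements of
nilpotent ideals to multiples of `n`. -/
theorem fst_eq_zero_of_mem_nilpotent {k L : Type*} [Field k] [LieRing L] [LieAlgebra k L]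
    (h : L →ₗ⁅k⁆ AffineLie k) {y : L} (hy : (h y).fst = 0) (hy' : (h y).snd ≠ 0)
    {I : LieIdeal k L} (hI : LieRing.IsNilpotent I) {x : L} (hx : x ∈ I) : (h x).fst = 0 := by
  obtain ⟨n, hn⟩ := exists_ad_pow_lie_eq_zero hI hx
  have := apply_ad_pow h x ⁅x, y⁆ (by simp) n
  rw [hn, map_zero] at this
  have := congrArg snd this
  by_contra hne
  simp [hy, hy', hne] at this

end AffineLie

section Field

variable {k L : Type*} [Field k] [LieRing L] [LieAlgebra k L]

theorem exists_functional_of_notMem_commutant {x : L} (hx : x ∉ commutant k L) :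
    ∃ f : L →ₗ[k] k, (∀ a b : L, f ⁅a, b⁆ = 0) ∧ f x ≠ 0 := by
  obtain ⟨f, hf, hle⟩ := Submodule.exists_le_ker_of_notMem (p := (commutant k L).toSubmodule) hx
  exact ⟨f, fun a b => hle (lie_mem_commutant a b), hf⟩

theorem IsMetabelian.exists_functional [Nontrivial L] (h : IsMetabelian L) :
    ∃ f : L →ₗ[k] k, (∀ a b : L, f ⁅a, b⁆ = 0) ∧ ∃ x, f x ≠ 0 := by
  have : ∃ x, x ∉ commutant k L := by
    by_contra! hall
    exact h.commutant_ne_top (k := k) (eq_top_iff.2 fun x _ => hall x)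
  obtain ⟨x, hx⟩ := this
  obtain ⟨f, hf, hfx⟩ := exists_functional_of_notMem_commutant hx
  exact ⟨f, hf, x, hfx⟩

end Field

open AffineLie MetabelianProduct in
theorem mainTheorem3 {k A B I J : Type*} [Field k]
    [LieRing A] [LieAlgebra k A] [LieRing B] [LieAlgebra k B]
    (hA : IsMetabelian A) (hB : IsMetabelian B) [Nontrivial A] [Nontrivial B]
    (P : MetabelianPresentation k A I) (Q : MetabelianPresentation k B J) :
    fittingRadical k (MetabelianProduct P Q) = commutant k (MetabelianProduct P Q) := by
  refine le_antisymm (LieSubmodule.lieSpan_le.2 ?_)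
    isMetabelian_presented.commutant_le_fittingRadical
  rintro x ⟨N, hN, hx⟩
  by_contra hxc
  obtain ⟨l, hl, hlx⟩ := exists_functional_of_notMem_commutant hxc
  obtain ⟨f, hf, a, hfa⟩ := hA.exists_functional (k := k)
  obtain ⟨g, hg, b, hgb⟩ := hB.exists_functional (k := k)
  -- The `e`-coordinate of `u` is `l` on `A` and zero on `B`; for `v` the roles are exchanged.
  obtain ⟨u, hul, hur⟩ := exists_desc P Q AffineLie.isMetabelian
    (ofFunctional 1 0 (l ∘ₗ (inlHom P Q : A →ₗ[k] MetabelianProduct P Q)) (by simp [hl]))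
    (ofFunctional 0 1 g hg)
  obtain ⟨v, hvl, hvr⟩ := exists_desc P Q AffineLie.isMetabelian
    (ofFunctional 0 1 f hf)
    (ofFunctional 1 0 (l ∘ₗ (inrHom P Q : B →ₗ[k] MetabelianProduct P Q)) (by simp [hl]))
  have hu : (u x).fst = 0 :=
    fst_eq_zero_of_mem_nilpotent u (y := inrHom P Q b) (by simp [hur]) (by simpa [hur]) hN hx
  have hv : (v x).fst = 0 :=
    fst_eq_zero_of_mem_nilpotent v (y := inlHom P Q a) (by simp [hvl]) (by simpa [hvl]) hN hx
  -- To compare `l` with the sum of the `e`-coordinates on the factors alone, both are made Lie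
  -- homomorphisms into the line of `e`.
  have hsum := hom_ext P Q (f := ofFunctional 1 0 l hl)
    (g := ofFunctional 1 0 (fstₗ ∘ₗ (u : MetabelianProduct P Q →ₗ[k] AffineLie k) +
      fstₗ ∘ₗ (v : MetabelianProduct P Q →ₗ[k] AffineLie k)) (by simp [fstₗ]))
    (by simp [fstₗ, hul, hvl]) (by simp [fstₗ, hur, hvr]) x
  have := congrArg fst hsum
  simp [fstₗ, hu, hv] at this
  exact hlx this
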